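/- Modal formulas are built from $\bot,\top$, literals $p,\neg p$ (over countably many propositional variables), $\wedge,\vee,\Box,\Diamond$; negation and implication are the usual defined operations. Let $l$ be any modal logic obtained from the smallest normal modal logic $\mathbf{K}$ by adding a (possibly empty) subset of the axioms $D:\Diamond\top$, $T:\Box\varphi\to\varphi$, $4:\Box\varphi\to\Box\Box\varphi$, $5:\Diamond\varphi\to\Box\Diamond\varphi$. A formula $\varphi$ is *complete up to its depth* for $l$ if for every formula $\psi$ that uses only propositional variables occurring in $\varphi$ and whose modal depth is at most that of $\varphi$, either $\vdash_l\varphi\to\psi$ or $\vdash_l\varphi\to\neg\psi$. Then for every complexity class $C$ (any class of languages over finite alphabets): if the problem of deciding, given a formula $\varphi$, whether $\vdash_l\varphi$ is $C$-hard, then the problem of deciding, given a formula $\varphi$, whether $\varphi$ is complete up to its depth for $l$ is $C$-hard. Hardness is with respect to polynomial-time many-one reductions. This includes the logics $\mathbf{D}=\mathbf{K}+D$ and $\mathbf{T}=\mathbf{K}+T$. -/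

import Mathlib

/-- The axioms that may be added to the smallest normal modal logic `K`:
`D : ◇⊤`, `T : □φ → φ`, `4 : □φ → □□φ`, `5 : ◇φ → □◇φ`. -/
inductive ModalAxiom where
  | D
  | T
  | four
  | five

/-- A modal logic is given by the set of axioms added to `K`: for instance `∅` is `K`, `{D}` is `D`,
`{T, four}` is `S4`, `{D, four, five}` is `KD45`, `{T, four, five}` is `S5`. -/
abbrev ModalLogic : Type := Set ModalAxiom

/-- Modal formulas in negation normal form over the variables `p_0, p_1, …`;
`var n` is the literal `p_n` and `nvar n` the literal `¬p_n`. -/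
inductive ModalFormula where
  | bot
  | top
  | var (n : ℕ)
  | nvar (n : ℕ)
  | and (φ ψ : ModalFormula)
  | or (φ ψ : ModalFormula)
  | box (φ : ModalFormula)
  | dia (φ : ModalFormula)

namespace ModalFormula

/-- Negation, by the De Morgan laws and the duality of `□` and `◇`. -/
def neg : ModalFormula → ModalFormula
  | bot => top
  | top => bot
  | var n => nvar n
  | nvar n => var n
  | and φ ψ => or φ.neg ψ.neg
  | or φ ψ => and φ.neg ψ.neg
  | box φ => dia φ.neg
  | dia φ => box φ.neg

/-- The implication `φ → ψ`, that is `¬φ ∨ ψ`. -/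
def imp (φ ψ : ModalFormula) : ModalFormula := or φ.neg ψ

/-- The set of propositional variables that appear in a formula. -/
def vars : ModalFormula → Finset ℕ
  | bot => ∅
  | top => ∅
  | var n => {n}
  | nvar n => {n}
  | and φ ψ => φ.vars ∪ ψ.vars
  | or φ ψ => φ.vars ∪ ψ.vars
  | box φ => φ.vars
  | dia φ => φ.vars

/-- The modal depth: the largest nesting depth of modal operators. -/
def depth : ModalFormula → ℕ
  | bot => 0
  | top => 0
  | var _ => 0
  | nvar _ => 0
  | and φ ψ => max φ.depth ψ.depth
  | or φ ψ => max φ.depth ψ.depth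
  | box φ => φ.depth + 1
  | dia φ => φ.depth + 1

/-- A propositional valuation: an assignment of truth values to modal formulas that respects the
propositional connectives (including negation) and is otherwise arbitrary on modal formulas. -/
structure IsPropValuation (v : ModalFormula → Prop) : Prop where
  not_bot : ¬ v bot
  top : v top
  and_iff : ∀ φ ψ, v (and φ ψ) ↔ v φ ∧ v ψ
  or_iff : ∀ φ ψ, v (or φ ψ) ↔ v φ ∨ v ψ
  neg_iff : ∀ φ, v φ.neg ↔ ¬ v φ

/-- (Instances of) propositional tautologies. -/
def IsTautology (φ : ModalFormula) : Prop :=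
  ∀ v : ModalFormula → Prop, IsPropValuation v → v φ

/-- `Provable l φ` is `⊢_l φ`: derivability in the Hilbert system with all propositional
tautologies, axiom `K`, the axioms of `l`, Modus Ponens and Necessitation. -/
inductive Provable (l : ModalLogic) : ModalFormula → Prop where
  | taut {φ : ModalFormula} : IsTautology φ → Provable l φ
  | axK (φ ψ : ModalFormula) : Provable l (imp (and (box φ) (box (imp φ ψ))) (box ψ))
  | axD : ModalAxiom.D ∈ l → Provable l (dia top)
  | axT (φ : ModalFormula) : ModalAxiom.T ∈ l → Provable l (imp (box φ) φ)
  | ax4 (φ : ModalFormula) : ModalAxiom.four ∈ l → Provable l (imp (box φ) (box (box φ)))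
  | ax5 (φ : ModalFormula) : ModalAxiom.five ∈ l → Provable l (imp (dia φ) (box (dia φ)))
  | mp {φ ψ : ModalFormula} : Provable l φ → Provable l (imp φ ψ) → Provable l ψ
  | nec {φ : ModalFormula} : Provable l φ → Provable l (box φ)

/-- `φ` is complete up to its depth for `l`: it decides in `l` every formula over the variables of
`φ` whose modal depth is at most that of `φ`. -/
def CompleteUpToDepth (l : ModalLogic) (φ : ModalFormula) : Prop :=
  ∀ ψ : ModalFormula, ψ.vars ⊆ φ.vars → ψ.depth ≤ φ.depth →
    Provable l (imp φ ψ) ∨ Provable l (imp φ ψ.neg)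

/-- The finite alphabet in which formulas are written. -/
inductive Symbol where
  | bot
  | top
  | not
  | var
  | and
  | or
  | box
  | dia
  | bit (b : Bool)

/-- A formula as a string, in prefix notation; the index of a variable is written in binary. -/
def encode : ModalFormula → List Symbol
  | bot => [Symbol.bot]
  | top => [Symbol.top]
  | var n => Symbol.var :: (Computability.encodeNat n).map Symbol.bit
  | nvar n => Symbol.not :: Symbol.var :: (Computability.encodeNat n).map Symbol.bit
  | and φ ψ => Symbol.and :: (φ.encode ++ ψ.encode)
  | or φ ψ => Symbol.or :: (φ.encode ++ ψ.encode)
  | box φ => Symbol.box :: φ.encode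
  | dia φ => Symbol.dia :: φ.encode

end ModalFormula

/-- A decision problem: a language over a finite alphabet. -/
structure DecisionProblem where
  /-- the alphabet -/
  Alphabet : Type
  /-- the alphabet is finite -/
  [finite : Finite Alphabet]
  /-- the set of accepted strings -/
  lang : Language Alphabet

/-- The set `S` of instances, written as strings by `enc`, is hard for the class `C` of decision
problems under polynomial-time many-one reductions: for every problem in `C` there is a function,
computed by a Turing machine in polynomial time, that maps exactly the accepted strings
to elements of `S`. -/
def IsHardFor (C : Set DecisionProblem) {α Γ : Type} (enc : α → List Γ) (S : Set α) : Prop :=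
  ∀ A ∈ C, ∃ f : List A.Alphabet → α,
    Nonempty (Turing.TM2ComputableInPolyTime (id : List A.Alphabet → List A.Alphabet) enc f) ∧
    ∀ w : List A.Alphabet, w ∈ A.lang ↔ f w ∈ S

/-! ### Substitution and the reduction on formulas -/

namespace ModalFormula

/-! The reduction sends `φ` to `(p_0 ∨ ¬p_0) ∧ ¬φ'`, where `φ'` is `φ` with its variables renamed
away from `p_0`. If `φ` is provable, the image is inconsistent and so decides everything.
Conversely, a complete image decides `p_0`, about which it says nothing; substituting `⊥` or `⊤` for
`p_0` and undoing the renaming makes `¬φ` inconsistent (`completeUpToDepth_incompletion_iff`). Only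
closure under substitution is used, so the added axioms play no role.

For polynomial time, the renaming `p_n ↦ p_{2n+1}` inserts one bit, so that the image is computed by
a single right-to-left pass over the string (`encode_incompletion`). A given machine is extended by
one stack and two loops that perform this pass on its output (`comp_incompletion`). The output
length is at most linear in input length plus running time, so the loops keep the time polynomial.
-/

theorem neg_neg (φ : ModalFormula) : φ.neg.neg = φ := by
  induction φ <;> simp_all [neg]

/-- Uniform substitution of formulas for variables. -/
def subst (s : ℕ → ModalFormula) : ModalFormula → ModalFormula
  | bot => bot
  | top => top
  | var n => s n
  | nvar n => (s n).neg
  | and φ ψ => and (φ.subst s) (ψ.subst s)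
  | or φ ψ => or (φ.subst s) (ψ.subst s)
  | box φ => box (φ.subst s)
  | dia φ => dia (φ.subst s)

theorem subst_neg (s : ℕ → ModalFormula) (φ : ModalFormula) :
    φ.neg.subst s = (φ.subst s).neg := by
  induction φ <;> simp_all [neg, subst, neg_neg]

theorem subst_imp (s : ℕ → ModalFormula) (φ ψ : ModalFormula) :
    (imp φ ψ).subst s = imp (φ.subst s) (ψ.subst s) := by
  simp [imp, subst, subst_neg]

theorem subst_subst (s t : ℕ → ModalFormula) (φ : ModalFormula) :
    (φ.subst s).subst t = φ.subst fun n => (s n).subst t := by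
  induction φ <;> simp_all [subst, subst_neg]

theorem subst_var (φ : ModalFormula) : φ.subst var = φ := by
  induction φ <;> simp_all [subst, neg]

theorem IsPropValuation.imp_iff {v : ModalFormula → Prop} (hv : IsPropValuation v)
    (φ ψ : ModalFormula) : v (imp φ ψ) ↔ (v φ → v ψ) := by
  rw [imp, hv.or_iff, hv.neg_iff, imp_iff_not_or]

theorem IsPropValuation.comp_subst {v : ModalFormula → Prop} (hv : IsPropValuation v)
    (s : ℕ → ModalFormula) : IsPropValuation fun φ => v (φ.subst s) where
  not_bot := hv.not_bot
  top := hv.top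
  and_iff _ _ := hv.and_iff _ _
  or_iff _ _ := hv.or_iff _ _
  neg_iff φ := by rw [subst_neg, hv.neg_iff]

/-- Derivability is closed under uniform substitution. -/
theorem Provable.subst {l : ModalLogic} {φ : ModalFormula} (h : Provable l φ)
    (s : ℕ → ModalFormula) : Provable l (φ.subst s) := by
  induction h with
  | taut h => exact .taut fun v hv => h _ (hv.comp_subst s)
  | axK φ ψ => simpa only [subst_imp, ModalFormula.subst] using Provable.axK (l := l) _ _
  | axD h => exact .axD h
  | axT φ h => simpa only [subst_imp, ModalFormula.subst] using Provable.axT _ h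
  | ax4 φ h => simpa only [subst_imp, ModalFormula.subst] using Provable.ax4 _ h
  | ax5 φ h => simpa only [subst_imp, ModalFormula.subst] using Provable.ax5 _ h
  | mp _ _ ih₁ ih₂ => exact .mp ih₁ (by simpa only [subst_imp] using ih₂)
  | nec _ ih => exact .nec ih

/-- A formula with the variable `p_n` renamed to `p_{2n+1}`, so that `p_0` becomes fresh. -/
def shift (φ : ModalFormula) : ModalFormula := φ.subst fun n => var (2 * n + 1)

theorem shift_subst (φ χ : ModalFormula) :
    φ.shift.subst (fun n => if n = 0 then χ else var (n / 2)) = φ := by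
  have h : ∀ n, (2 * n + 1) / 2 = n := by omega
  simp [shift, subst_subst, subst, h, subst_var]

/-- The conjunction of `p_0 ∨ ¬p_0` and the negation of `φ`, whose variables are renamed so as to
avoid `p_0`. -/
def incompletion (φ : ModalFormula) : ModalFormula := and (or (var 0) (nvar 0)) φ.shift.neg

theorem completeUpToDepth_incompletion_iff (l : ModalLogic) (φ : ModalFormula) :
    CompleteUpToDepth l φ.incompletion ↔ Provable l φ := by
  constructor
  · intro h
    have key : ∀ χ ξ : ModalFormula, ξ.subst (fun n => if n = 0 then χ else var (n / 2)) = bot →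
        Provable l (imp φ.incompletion ξ) → Provable l φ := by
      intro χ ξ hξ hp
      have := hp.subst fun n => if n = 0 then χ else var (n / 2)
      rw [subst_imp, hξ] at this
      refine .mp this (.taut fun v hv => ?_)
      simp only [incompletion, subst, subst_neg, shift_subst, hv.imp_iff, hv.and_iff, hv.or_iff,
        hv.neg_iff, hv.not_bot]
      tauto
    -- The tautological conjunct is there to make `p_0` a variable of the image; its depth is 0, so
    -- completeness applies to it.
    rcases h (var 0) (by simp [incompletion, vars]) (by simp [depth]) with hp | hp
    · exact key bot _ (by simp [subst]) hp
    · exact key top _ (by simp [subst, neg]) hp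
  · intro h ψ _ _
    refine .inl (.mp (h.subst fun n => var (2 * n + 1)) (.taut fun v hv => ?_))
    simp only [incompletion, shift, hv.imp_iff, hv.and_iff, hv.neg_iff]
    tauto

/-! ### The reduction on strings -/

/-- Binary numerals are written with the least significant bit first. -/
theorem encodeNat_two_mul_add_one (n : ℕ) :
    Computability.encodeNat (2 * n + 1) = true :: Computability.encodeNat n := by
  have h : ((2 * n + 1 : ℕ) : Num) = Num.bit1 (n : Num) := by
    rw [← Num.to_nat_inj]
    simp [two_mul]
  rw [Computability.encodeNat, Computability.encodeNat, h]
  cases (n : Num) <;> rfl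

/-- The symbol of the dual connective. -/
def Symbol.dual : Symbol → Symbol
  | .bot => .top
  | .top => .bot
  | .and => .or
  | .or => .and
  | .box => .dia
  | .dia => .box
  | s => s

/-- Whether a symbol is the negation sign. -/
def Symbol.isNot : Symbol → Bool
  | .not => true
  | _ => false

/-- Whether a symbol is the sign that starts a variable. -/
def Symbol.isVar : Symbol → Bool
  | .var => true
  | _ => false

/-- The step of the right-to-left pass that rewrites the string of `φ` to that of `φ.shift.neg`. -/
def Symbol.negShift (s : Symbol) (w : List Symbol) : List Symbol :=
  if s.isNot then w.tail else if s.isVar then .not :: .var :: .bit true :: w else s.dual :: w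

theorem foldr_negShift_bits (b : List Bool) (w : List Symbol) :
    (b.map Symbol.bit).foldr Symbol.negShift w = b.map Symbol.bit ++ w := by
  induction b <;> simp_all [Symbol.negShift, Symbol.isNot, Symbol.isVar, Symbol.dual]

/-- Prefix notation lets each connective be dualized in place. For a literal, the sign `var` is met
first and always emits a `not`; if a `not` precedes it in the input, that one is met next and
removes the emitted one. -/
theorem foldr_negShift_encode (φ : ModalFormula) (w : List Symbol) :
    φ.encode.foldr Symbol.negShift w = φ.shift.neg.encode ++ w := by
  induction φ generalizing w <;>
    simp_all [Symbol.negShift, Symbol.isNot, Symbol.isVar, Symbol.dual, shift, subst, neg, encode,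
      foldr_negShift_bits, encodeNat_two_mul_add_one]

theorem encode_incompletion (φ : ModalFormula) :
    φ.incompletion.encode = .and :: .or :: .var :: .not :: .var ::
      φ.encode.foldr Symbol.negShift [] := by
  rw [foldr_negShift_encode]
  simp [incompletion, encode, Computability.encodeNat, Computability.encodeNum]

instance : Finite Symbol := by
  refine Finite.of_injective (β := Fin 8 ⊕ Bool) (fun
    | .bot => .inl 0
    | .top => .inl 1
    | .not => .inl 2
    | .var => .inl 3
    | .and => .inl 4
    | .or => .inl 5
    | .box => .inl 6
    | .dia => .inl 7
    | .bit b => .inr b) ?_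
  rintro (_ | _) (_ | _) h <;> simp_all

end ModalFormula

/-! ### Iterated steps and growth of stacks -/

namespace Turing

open StateTransition Function

section Iterate

variable {σ τ : Type*} {f : σ → Option σ}

theorem iterate_bind_none (n : ℕ) : (flip bind f)^[n] none = none := by
  induction n with
  | zero => rfl
  | succ n ih => rw [iterate_succ_apply]; exact ih

theorem iterate_bind_succ (n : ℕ) (a : σ) :
    (flip bind f)^[n + 1] (some a) = (flip bind f)^[n] (f a) := rfl

theorem iterate_bind_map {g : τ → Option τ} {e : σ → τ}
    (h : ∀ a b, f a = some b → g (e a) = some (e b)) (n : ℕ) (a b : σ) (hab : (flip bind f)^[n] (some a) = some b) :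
    (flip bind g)^[n] (some (e a)) = some (e b) := by
  induction n generalizing a with
  | zero => cases hab; rfl
  | succ n ih =>
    rw [iterate_bind_succ] at hab ⊢
    cases hfa : f a with
    | none => rw [hfa, iterate_bind_none] at hab; cases hab
    | some c => rw [h a c hfa]; rw [hfa] at hab; exact ih c hab

theorem iterate_bind_le {m : σ → ℕ} {B : ℕ} (h : ∀ a b, f a = some b → m b ≤ m a + B)
    (n : ℕ) (a b : σ) (hab : (flip bind f)^[n] (some a) = some b) : m b ≤ m a + n * B := by
  induction n generalizing a with
  | zero => cases hab; simp
  | succ n ih =>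
    rw [iterate_bind_succ] at hab
    cases hfa : f a with
    | none => rw [hfa, iterate_bind_none] at hab; cases hab
    | some c =>
      rw [hfa] at hab
      have h₁ := ih c hab
      have h₂ := h a c hfa
      rw [Nat.succ_mul]
      omega

end Iterate

namespace TM2.Stmt

variable {K : Type*} {Γ : K → Type*} {Λ σ : Type*}

/-- The number of `push` instructions in a statement. -/
def pushCount : Stmt Γ Λ σ → ℕ
  | push _ _ q => pushCount q + 1
  | peek _ _ q => pushCount q
  | pop _ _ q => pushCount q
  | load _ q => pushCount q
  | branch _ q₁ q₂ => pushCount q₁ + pushCount q₂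
  | goto _ => 0
  | halt => 0

/-- Only a `push` lengthens a stack. Counting both arms of a branch overestimates, but gives a bound
independent of the state. -/
theorem length_stk_stepAux_le [DecidableEq K] (q : Stmt Γ Λ σ) (v : σ) (S : ∀ k, List (Γ k))
    (k : K) : ((stepAux q v S).stk k).length ≤ (S k).length + q.pushCount := by
  induction q generalizing v S with
  | push k' f q ih =>
    refine (ih _ _).trans ?_
    rcases eq_or_ne k k' with rfl | h
    · simp [pushCount]; omega
    · simp [pushCount, h]
  | peek k' f q ih => exact ih _ _
  | pop k' f q ih =>
    refine (ih _ _).trans ?_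
    rcases eq_or_ne k k' with rfl | h
    · simp [pushCount]
    · simp [pushCount, h]
  | load f q ih => exact ih _ _
  | branch f q₁ q₂ ih₁ ih₂ =>
    simp only [stepAux, pushCount]
    cases f v
    · exact (ih₂ _ _).trans (by omega)
    · exact (ih₁ _ _).trans (by omega)
  | goto f => simp [pushCount]
  | halt => simp [pushCount]

end TM2.Stmt

theorem length_stk_step_le (tm : FinTM2) (c c' : tm.Cfg) (h : tm.step c = some c') (k : tm.K) :
    (c'.stk k).length ≤
      (c.stk k).length + letI := tm.ΛFin; ∑ l : tm.Λ, (tm.m l).pushCount := by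
  let := tm.ΛFin
  rcases c with ⟨_ | l, v, S⟩
  · cases h
  · cases h
    exact (TM2.Stmt.length_stk_stepAux_le _ _ _ _).trans (Nat.add_le_add_left
      (Finset.single_le_sum (f := fun l => (tm.m l).pushCount) (fun _ _ => Nat.zero_le _)
        (Finset.mem_univ l)) _)

theorem initList_eq (tm : FinTM2) (s : List (tm.Γ tm.k₀)) :
    initList tm s = ⟨some tm.main, tm.initialState, update (fun _ => []) tm.k₀ s⟩ := by
  unfold initList
  congr 1
  funext k
  by_cases h : k = tm.k₀
  · subst h; simp
  · simp [h]

theorem haltList_eq (tm : FinTM2) (s : List (tm.Γ tm.k₁)) :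
    haltList tm s = ⟨none, tm.initialState, update (fun _ => []) tm.k₁ s⟩ := by
  unfold haltList
  congr 1
  funext k
  by_cases h : k = tm.k₁
  · subst h; simp
  · simp [h]

theorem length_update_nil_le {K : Type*} [DecidableEq K] {Γ : K → Type*} (k k' : K)
    (s : List (Γ k')) : (update (β := fun k => List (Γ k)) (fun _ => []) k' s k).length ≤
      s.length := by
  rcases eq_or_ne k k' with rfl | h <;> simp [*]

/-! ### The extended machine -/

namespace FinTM2

open ModalFormula TM2.Stmt

variable (tm : FinTM2) (e : tm.Γ tm.k₁ ≃ Symbol)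

/-- The stack alphabets of `tm`, with an additional stack of symbols. -/
abbrev ExtΓ : Option tm.K → Type
  | none => Symbol
  | some k => tm.Γ k

/-- The labels of `tm` and the labels of two additional loops. -/
abbrev ExtΛ : Type := tm.Λ ⊕ Bool

/-- The states of `tm`, with a register for a symbol. -/
abbrev Extσ : Type := tm.σ × Option Symbol

variable {tm} in
/-- A statement of `tm` as a statement of the extended machine, which enters the first additional
loop instead of halting. -/
def extStmt : TM2.Stmt tm.Γ tm.Λ tm.σ → TM2.Stmt tm.ExtΓ tm.ExtΛ tm.Extσ
  | push k f q => push (some k) (fun s => f s.1) (extStmt q)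
  | peek k f q => peek (some k) (fun s x => (f s.1 x, s.2)) (extStmt q)
  | pop k f q => pop (some k) (fun s x => (f s.1 x, s.2)) (extStmt q)
  | load f q => load (fun s => (f s.1, s.2)) (extStmt q)
  | branch f q₁ q₂ => branch (fun s => f s.1) (extStmt q₁) (extStmt q₂)
  | goto f => goto fun s => .inl (f s.1)
  | halt => goto fun _ => .inr false

/-- The body of the loop that moves the output of `tm` to the additional stack. -/
def unloadStmt : TM2.Stmt tm.ExtΓ tm.ExtΛ tm.Extσ :=
  pop (some tm.k₁) (fun s (x : Option (tm.Γ tm.k₁)) => (s.1, x.map e)) <|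
  branch (fun s => s.2.isSome)
    (push none (fun s => s.2.getD Symbol.bot) <| goto fun _ => .inr false)
    (goto fun _ => .inr true)

/-- The body of the loop that moves the additional stack back to the output stack while applying
`Symbol.negShift`, and then completes the string of an `incompletion`. -/
def reloadStmt : TM2.Stmt tm.ExtΓ tm.ExtΛ tm.Extσ :=
  pop none (fun s (x : Option Symbol) => (s.1, x)) <|
  branch (fun s => s.2.isSome)
    (branch (fun s => (s.2.getD Symbol.bot).isNot)
      (pop (some tm.k₁) (fun s _ => s) <| goto fun _ => .inr true) <|
    branch (fun s => (s.2.getD Symbol.bot).isVar)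
      (push (some tm.k₁) (fun _ => e.symm (.bit true)) <|
        push (some tm.k₁) (fun _ => e.symm .var) <|
        push (some tm.k₁) (fun _ => e.symm .not) <| goto fun _ => .inr true)
      (push (some tm.k₁) (fun s => e.symm (s.2.getD Symbol.bot).dual) <|
        goto fun _ => .inr true))
    -- The prefix for `(p_0 ∨ ¬p_0) ∧ …` is pushed last symbol first; the index 0 has an empty
    -- numeral.
    (push (some tm.k₁) (fun _ => e.symm .var) <|
      push (some tm.k₁) (fun _ => e.symm .not) <|
      push (some tm.k₁) (fun _ => e.symm .var) <|
      push (some tm.k₁) (fun _ => e.symm .or) <|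
      push (some tm.k₁) (fun _ => e.symm .and) halt)

/-- The program of the extended machine. -/
def extProg : tm.ExtΛ → TM2.Stmt tm.ExtΓ tm.ExtΛ tm.Extσ
  | .inl l => extStmt (tm.m l)
  | .inr false => tm.unloadStmt e
  | .inr true => tm.reloadStmt e

/-- The machine that runs `tm` and then turns its output `φ.encode` into
`φ.incompletion.encode`. -/
noncomputable def ext : FinTM2 :=
  letI := tm.kFin
  letI := tm.ΛFin
  letI := tm.σFin
  letI := Fintype.ofFinite Symbol
  { K := Option tm.K
    k₀ := some tm.k₀
    k₁ := some tm.k₁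
    Γ := tm.ExtΓ
    Λ := tm.ExtΛ
    main := .inl tm.main
    σ := tm.Extσ
    initialState := (tm.initialState, none)
    Γk₀Fin := tm.Γk₀Fin
    m := tm.extProg e }

variable {tm} in
/-- The stacks of the extended machine. -/
def extStk (S : ∀ k, List (tm.Γ k)) (b : List Symbol) : ∀ k, List (tm.ExtΓ k)
  | none => b
  | some k => S k

theorem update_extStk_some (S : ∀ k, List (tm.Γ k)) (b : List Symbol) (k : tm.K)
    (x : List (tm.Γ k)) :
    update (β := fun k => List (tm.ExtΓ k)) (extStk S b) (some k) x = extStk (update S k x) b := by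
  funext k'
  rcases k' with _ | k'
  · exact update_of_ne (Option.some_ne_none k).symm _ _
  · rcases eq_or_ne k' k with rfl | h
    · exact (update_self (β := fun k => List (tm.ExtΓ k)) _ _ _).trans
        (update_self (β := fun k => List (tm.Γ k)) _ _ _).symm
    · exact (update_of_ne (β := fun k => List (tm.ExtΓ k)) (by simpa using h) _ _).trans
        (update_of_ne (β := fun k => List (tm.Γ k)) h _ _).symm

theorem update_extStk_none (S : ∀ k, List (tm.Γ k)) (b x : List Symbol) :
    update (β := fun k => List (tm.ExtΓ k)) (extStk S b) none x = extStk S x := by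
  funext k'
  rcases k' with _ | k'
  · exact update_self (β := fun k => List (tm.ExtΓ k)) _ _ _
  · exact update_of_ne (β := fun k => List (tm.ExtΓ k)) (Option.some_ne_none k') _ _

variable {tm} in
/-- A configuration of `tm` as a configuration of the extended machine. -/
def extCfg (c : TM2.Cfg tm.Γ tm.Λ tm.σ) : TM2.Cfg tm.ExtΓ tm.ExtΛ tm.Extσ :=
  ⟨some (c.l.elim (.inr false) .inl), (c.var, none), extStk c.stk []⟩

theorem stepAux_extStmt (q : TM2.Stmt tm.Γ tm.Λ tm.σ) (v : tm.σ) (S : ∀ k, List (tm.Γ k)) :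
    TM2.stepAux (extStmt q) (v, none) (extStk S []) = extCfg (TM2.stepAux q v S) := by
  induction q generalizing v S with
  | push k f q ih => exact (congrArg _ (update_extStk_some ..)).trans (ih _ _)
  | peek k f q ih => exact ih _ _
  | pop k f q ih => exact (congrArg _ (update_extStk_some ..)).trans (ih _ _)
  | load f q ih => exact ih _ _
  | branch f q₁ q₂ ih₁ ih₂ =>
    simp only [extStmt, TM2.stepAux]
    cases f v
    · exact ih₂ _ _
    · exact ih₁ _ _
  | goto f => rfl
  | halt => rfl

theorem step_ext (c c' : tm.Cfg) (h : tm.step c = some c') :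
    TM2.step (tm.extProg e) (extCfg c) = some (extCfg c') := by
  rcases c with ⟨_ | l, v, S⟩
  · cases h
  · cases h
    exact congrArg some (tm.stepAux_extStmt (tm.m l) v S)

variable {tm} in
/-- The stacks of the extended machine in one of its loops. -/
def loopStk (a : List (tm.Γ tm.k₁)) (b : List Symbol) : ∀ k, List (tm.ExtΓ k) :=
  extStk (update (fun _ => []) tm.k₁ a) b

section Loop

variable {tm} (a : List (tm.Γ tm.k₁)) (b : List Symbol) (v : tm.Extσ)
  (q : TM2.Stmt tm.ExtΓ tm.ExtΛ tm.Extσ)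

theorem loopStk_some : loopStk a b (some tm.k₁) = a :=
  update_self (β := fun k => List (tm.Γ k)) tm.k₁ a fun _ => []

theorem update_loopStk_some (x : List (tm.Γ tm.k₁)) :
    update (β := fun k => List (tm.ExtΓ k)) (loopStk a b) (some tm.k₁) x = loopStk x b := by
  rw [loopStk, update_extStk_some, update_idem]; rfl

theorem stepAux_push_output (f : tm.Extσ → tm.Γ tm.k₁) :
    TM2.stepAux (push (Γ := tm.ExtΓ) (some tm.k₁) f q) v (loopStk a b) =
      TM2.stepAux q v (loopStk (f v :: a) b) := by
  rw [← update_loopStk_some a b (f v :: a)]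
  exact congrArg (fun y : List (tm.Γ tm.k₁) => TM2.stepAux q v
    (update (β := fun k => List (tm.ExtΓ k)) (loopStk a b) (some tm.k₁) (f v :: y)))
    (loopStk_some a b)

theorem stepAux_pop_output (f : tm.Extσ → Option (tm.Γ tm.k₁) → tm.Extσ) :
    TM2.stepAux (pop (Γ := tm.ExtΓ) (some tm.k₁) f q) v (loopStk a b) =
      TM2.stepAux q (f v a.head?) (loopStk a.tail b) := by
  rw [← update_loopStk_some a b a.tail]
  exact congrArg (fun y : List (tm.Γ tm.k₁) => TM2.stepAux q (f v y.head?)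
    (update (β := fun k => List (tm.ExtΓ k)) (loopStk a b) (some tm.k₁) y.tail))
    (loopStk_some a b)

theorem stepAux_push_extra (f : tm.Extσ → Symbol) :
    TM2.stepAux (push (Γ := tm.ExtΓ) none f q) v (loopStk a b) =
      TM2.stepAux q v (loopStk a (f v :: b)) :=
  congrArg (TM2.stepAux q v) (update_extStk_none ..)

theorem stepAux_pop_extra (f : tm.Extσ → Option Symbol → tm.Extσ) :
    TM2.stepAux (pop (Γ := tm.ExtΓ) none f q) v (loopStk a b) =
      TM2.stepAux q (f v b.head?) (loopStk a b.tail) :=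
  congrArg (TM2.stepAux q _) (update_extStk_none ..)

end Loop

variable {tm} in
/-- The configuration of the extended machine in one of its loops. -/
def loopCfg (i : Bool) (x : Option Symbol) (a : List (tm.Γ tm.k₁)) (b : List Symbol) :
    TM2.Cfg tm.ExtΓ tm.ExtΛ tm.Extσ :=
  ⟨some (.inr i), (tm.initialState, x), loopStk a b⟩

theorem step_unload (a : List (tm.Γ tm.k₁)) (b : List Symbol) (x : Option Symbol) :
    TM2.step (tm.extProg e) (loopCfg false x a b) =
      some (TM2.stepAux (tm.unloadStmt e) (tm.initialState, x) (loopStk a b)) := rfl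

theorem step_reload (a : List (tm.Γ tm.k₁)) (b : List Symbol) (x : Option Symbol) :
    TM2.step (tm.extProg e) (loopCfg true x a b) =
      some (TM2.stepAux (tm.reloadStmt e) (tm.initialState, x) (loopStk a b)) := rfl

/-- One step per symbol and one that finds the stack empty. The transfer reverses the output, so
that the second loop meets its last symbol first, as a right fold requires. -/
theorem iterate_unload (a : List (tm.Γ tm.k₁)) (b : List Symbol) (x : Option Symbol) :
    (flip bind (TM2.step (tm.extProg e)))^[a.length + 1] (some (loopCfg false x a b)) =
      some (loopCfg true none [] ((a.map e).reverse ++ b)) := by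
  induction a generalizing b x with
  | nil =>
    rw [iterate_bind_succ, step_unload, unloadStmt, stepAux_pop_output]
    rfl
  | cons s a ih =>
    rw [iterate_bind_succ, step_unload, unloadStmt, stepAux_pop_output]
    simp only [TM2.stepAux.eq_5, List.head?_cons, Option.map_some, Option.isSome_some, cond_true,
      stepAux_push_extra, List.map_cons, List.reverse_cons, List.append_assoc]
    exact ih (e s :: b) (some (e s))

theorem update_nil_eq_loopStk (a : List (tm.Γ tm.k₁)) :
    update (β := fun k => List (tm.ExtΓ k)) (fun _ => []) (some tm.k₁) a = loopStk a [] := by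
  have h : (fun _ => [] : ∀ k, List (tm.ExtΓ k)) = loopStk [] [] := by
    funext k
    rcases k with _ | k
    · rfl
    · exact (congrFun (update_eq_self tm.k₁ (fun k => ([] : List (tm.Γ k)))) k).symm
  rw [h, update_loopStk_some]

theorem haltList_ext (a : List (tm.Γ tm.k₁)) :
    haltList (tm.ext e) a =
      (⟨none, (tm.initialState, none), loopStk a []⟩ : TM2.Cfg tm.ExtΓ tm.ExtΛ tm.Extσ) :=
  (haltList_eq (tm.ext e) a).trans
    (congrArg (TM2.Cfg.mk none (tm.initialState, none)) (tm.update_nil_eq_loopStk a))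

theorem stepAux_reload_cons (s : Symbol) (b w : List Symbol) (x : Option Symbol) :
    (TM2.stepAux (tm.reloadStmt e) (tm.initialState, x) (loopStk (w.map e.symm) (s :: b))) =
      loopCfg true (some s) ((s.negShift w).map e.symm) b := by
  simp only [reloadStmt, stepAux_pop_extra, TM2.stepAux.eq_5, List.head?_cons, List.tail_cons,
    Option.isSome_some, Option.getD_some, Symbol.negShift, stepAux_pop_output,
    stepAux_push_output, Bool.cond_eq_ite]
  split_ifs <;> simp [loopCfg, List.map_tail]

/-- The final pop, from the empty stack, also resets the register to `none`, as the halting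
configuration demands. -/
theorem iterate_reload (b w : List Symbol) (x : Option Symbol) :
    (flip bind (TM2.step (tm.extProg e)))^[b.length + 1]
        (some (loopCfg true x (w.map e.symm) b)) =
      some ⟨none, (tm.initialState, none), loopStk ((.and :: .or :: .var :: .not :: .var ::
        b.reverse.foldr Symbol.negShift w).map e.symm) []⟩ := by
  induction b generalizing w x with
  | nil =>
    rw [iterate_bind_succ, step_reload, reloadStmt, stepAux_pop_extra]
    simp only [TM2.stepAux.eq_5, List.head?_nil, Option.isSome_none, cond_false,
      stepAux_push_output]
    rfl
  | cons s b ih =>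
    rw [iterate_bind_succ, step_reload, stepAux_reload_cons, List.length_cons, ih]
    simp

theorem initList_ext (a : List (tm.Γ tm.k₀)) :
    initList (tm.ext e) a = extCfg (initList tm a) := by
  have h : (fun _ => [] : ∀ k, List (tm.ExtΓ k)) = extStk (fun _ => []) [] := by
    funext k
    rcases k with _ | k <;> rfl
  refine (initList_eq (tm.ext e) a).trans ?_
  rw [initList_eq, extCfg, ← update_extStk_some, ← h]
  rfl

theorem extCfg_haltList (a : List (tm.Γ tm.k₁)) :
    extCfg (haltList tm a) = loopCfg false none a [] := by
  rw [haltList_eq]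
  rfl

end FinTM2

/-! ### Composition in polynomial time -/

open ModalFormula

/-- Polynomial-time computability is preserved by composition with `incompletion`. -/
theorem TM2ComputableInPolyTime.comp_incompletion {α αΓ : Type} {ea : α → List αΓ}
    {f : α → ModalFormula} (h : TM2ComputableInPolyTime ea encode f) :
    Nonempty (TM2ComputableInPolyTime ea encode fun a => (f a).incompletion) := by
  obtain ⟨⟨tm, i, e⟩, time, out⟩ := h
  dsimp only at out
  let := tm.ΛFin
  let B := ∑ l : tm.Λ, (tm.m l).pushCount
  -- Each loop takes one step more than the output length, which is at most the input length plus
  -- `B` per step of `tm`.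
  refine ⟨⟨⟨tm.ext e, i, e⟩, 2 * (Polynomial.X + time * Polynomial.C B + 1) + time, fun a => ?_⟩⟩
  obtain ⟨⟨n, hn⟩, hle⟩ := out a
  dsimp only at hle
  have hA := iterate_bind_map (tm.step_ext e) n _ _ hn
  have hB := tm.iterate_unload e ((f a).encode.map e.symm) [] none
  have hC := tm.iterate_reload e (f a).encode.reverse [] none
  simp only [List.length_map, List.map_map, List.append_nil, List.length_reverse,
    List.reverse_reverse, Equiv.self_comp_symm, List.map_id, List.map_nil] at hB hC
  -- The rightmost summand is executed first: `n` steps of `tm`, then unloading, then reloading.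
  have hrun : (flip bind (TM2.step (tm.extProg e)))^[((f a).encode.length + 1) +
      (((f a).encode.length + 1) + n)] (some (FinTM2.extCfg (initList tm ((ea a).map i.invFun)))) =
      some ⟨none, (tm.initialState, none),
        FinTM2.loopStk ((f a).incompletion.encode.map e.symm) []⟩ := by
    rw [iterate_add_apply _ ((f a).encode.length + 1), iterate_add_apply _ _ n, hA]
    refine (congrArg _ (congrArg _ (congrArg some (tm.extCfg_haltList _)))).trans ?_
    refine (congrArg _ hB).trans ?_
    rw [hC, encode_incompletion]
  have hlen : (f a).encode.length ≤ (ea a).length + n * B := by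
    have := iterate_bind_le (m := fun c : tm.Cfg => (c.stk tm.k₁).length)
      (fun c c' hc => length_stk_step_le tm c c' hc tm.k₁) n _ _ hn
    rw [initList_eq, haltList_eq] at this
    simp only [update_self, List.length_map] at this
    refine this.trans (Nat.add_le_add_right ?_ _)
    exact (length_update_nil_le ..).trans_eq (List.length_map _)
  rw [← tm.initList_ext e, ← tm.haltList_ext e] at hrun
  refine ⟨⟨_, hrun⟩, ?_⟩
  have : n * B ≤ time.eval (ea a).length * B := Nat.mul_le_mul_right _ hle
  simp only [Polynomial.eval_add, Polynomial.eval_mul, Polynomial.eval_X, Polynomial.eval_C,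
    Polynomial.eval_one, Polynomial.eval_ofNat]
  omega

end Turing

theorem mainTheorem10 (l : ModalLogic) (C : Set DecisionProblem)
    (hC : IsHardFor C ModalFormula.encode {φ | ModalFormula.Provable l φ}) :
    IsHardFor C ModalFormula.encode {φ | ModalFormula.CompleteUpToDepth l φ} := by
  intro A hA
  obtain ⟨f, ⟨hf⟩, h⟩ := hC A hA
  exact ⟨fun w => (f w).incompletion, hf.comp_incompletion, fun w => (h w).trans
    (ModalFormula.completeUpToDepth_incompletion_iff l (f w)).symm⟩
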